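/- Let items $d_1,d_2,\dots$ be requested by an i.i.d. sequence $(R_n)_{n\in\mathbb Z}$ with $\mathbb P[R_n=d_i]=q_i$, where $(q_i)$ is non-increasing and $q_i\sim c/i^{\alpha}$ as $i\to\infty$ for some constants $\alpha>1$ and $c>0$. Let $H$ be a random hash function, independent of the requests, that assigns the items to servers $1,\dots,N$: the values $H(d_i)$, $i\ge 1$, are independent with $\mathbb P[H(d_i)=m]=\mu_m$. Let $J_n=H(R_n)$ be the server that processes the $n$-th request. Every server sorts the items hashed to it by their last access, the most recently accessed item first (move-to-front, i.e. LRU), and $C_n$ is the position of $R_n$, just before the $n$-th request, in the list of server $J_n$ (an item that was never accessed has position $\infty$). Server $m$ has cache size $b_m x$, where $b_m>0$, and the miss probability of the cluster given $H$ is $$\mathbb P^{\mathcal C,H}_{\mathrm{miss}}(x)=\sum_{m=1}^N\mathbb P[C_0>b_m x\mid J_0=m,H]\;\mathbb P[J_0=m\mid H],$$ where terms with $\mathbb P[J_0=m\mid H]=0$ are $0$. Let $\bar C_0$ be the position of $R_0$, just before request $0$, in the list of all items sorted in the same way; thus $\mathbb P[\bar C_0>y\mid H]$ is the miss probability, given $H$,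 of a single virtual LRU cache of size $y$ that serves all requests (by independence it does not depend on $H$). Then, for almost every realization of $H$, $$\lim_{x\to\infty}\frac{\mathbb P^{\mathcal C,H}_{\mathrm{miss}}(x)}{\mathbb P[\bar C_0>\bar x\mid H]}=1,\qquad \bar x=x\Big(\sum_{m=1}^N\mu_m^{\alpha}\,b_m^{1-\alpha}\Big)^{-1/(\alpha-1)}.$$ -/

import Mathlib

open MeasureTheory ProbabilityTheory Filter Topology
open scoped ENNReal

namespace LRUCluster

/-- Data items are numbered by `ℕ` (item `i` is the `(i+1)`-st most popular one), and
`r : ℤ → ℕ` is a two-sided sequence of requests: `r n` is the item asked for by the `n`-th request.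
`MoreRecent r n e d`: just before the `n`-th request, the last access to item `e` is more recent
than the last access to item `d` (in particular `e` has been accessed). -/
def MoreRecent (r : ℤ → ℕ) (n : ℤ) (e d : ℕ) : Prop :=
  ∃ k < n, r k = e ∧ ∀ j, k ≤ j → j < n → r j ≠ d

open Classical in
/-- The position of item `d`, just before the `n`-th request, in the move-to-front list of a server
that hosts the items in `A`: the items of `A` are sorted by their last access, the most recently
accessed item being in position `1`. An item that has never been accessed has position `∞`. -/
noncomputable def mtfPosition (A : Set ℕ) (r : ℤ → ℕ) (n : ℤ) (d : ℕ) : ℕ∞ :=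
  if ∃ k < n, r k = d then 1 + Set.encard {e | e ∈ A ∧ MoreRecent r n e d} else ⊤

/-- `J_n`: the server that processes the `n`-th request, when item `i` is hashed to server `h i`. -/
def server {N : ℕ} (h : ℕ → Fin N) (r : ℤ → ℕ) (n : ℤ) : Fin N := h (r n)

/-- `C_n` in the cluster with hash function `h`: the position of the `n`-th requested item in the
move-to-front list of the server that processes this request. -/
noncomputable def clusterPosition {N : ℕ} (h : ℕ → Fin N) (r : ℤ → ℕ) (n : ℤ) : ℕ∞ :=
  mtfPosition {e | h e = server h r n} r n (r n)

/-- `C_n` in a single LRU cache that serves all the requests. -/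
noncomputable def singlePosition (r : ℤ → ℕ) (n : ℤ) : ℕ∞ :=
  mtfPosition Set.univ r n (r n)

/-- `ℙ[C_0 > y | J_0 = m]` for the hash function `h`, where `ρ` is the law of the requests:
the miss probability on server `m` if its cache has size `y`. -/
noncomputable def serverMissProb {N : ℕ} (ρ : Measure (ℤ → ℕ)) (h : ℕ → Fin N) (m : Fin N)
    (y : ℝ) : ℝ :=
  (ProbabilityTheory.cond ρ {r | server h r 0 = m}).real
    {r | ENNReal.ofReal y < (clusterPosition h r 0 : ℝ≥0∞)}

/-- `∑ m, ℙ[C_0 > y m | J_0 = m] ℙ[J_0 = m]`: the miss probability of the cluster with hash function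
`h` and cache sizes `y m`, where `ρ` is the law of the requests. -/
noncomputable def clusterMissProb {N : ℕ} (ρ : Measure (ℤ → ℕ)) (h : ℕ → Fin N)
    (y : Fin N → ℝ) : ℝ :=
  ∑ m, serverMissProb ρ h m (y m) * ρ.real {r | server h r 0 = m}

/-- `ℙ[C_0 > y]` for a single LRU cache of size `y` that serves all the requests, where `ρ` is the
law of the requests. -/
noncomputable def singleMissProb (ρ : Measure (ℤ → ℕ)) (y : ℝ) : ℝ :=
  ρ.real {r | ENNReal.ofReal y < (singlePosition r 0 : ℝ≥0∞)}

/-- The size `x (∑ m, μ_m ^ α b_m ^ (1 - α)) ^ (-1 / (α - 1))` of the virtual cache. -/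
noncomputable def virtualSize {N : ℕ} (α : ℝ) (μ b : Fin N → ℝ) (x : ℝ) : ℝ :=
  x * (∑ m, μ m ^ α * b m ^ (1 - α)) ^ (-1 / (α - 1))

/-- The requests `R n`, `n ∈ ℤ`, and the hash values `H i` of the items `i`, on a probability space
`(Ω, P)`: the hash values are independent with `P[H i = m] = μ m`, the requests are independent with
`P[R n = i] = q i`, and the requests are independent of the hash function. -/
structure IsModel {Ω : Type*} [MeasurableSpace Ω] (P : Measure Ω) {N : ℕ} (μ : Fin N → ℝ)
    (q : ℕ → ℝ) (H : ℕ → Ω → Fin N) (R : ℤ → Ω → ℕ) : Prop where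
  measurable_hash : ∀ i, Measurable (H i)
  indep_hash : iIndepFun H P
  law_hash : ∀ i m, P.real {ω | H i ω = m} = μ m
  measurable_request : ∀ n, Measurable (R n)
  indep_request : iIndepFun R P
  law_request : ∀ n i, P.real {ω | R n ω = i} = q i
  indep_hash_request : IndepFun (fun ω i => H i ω) (fun ω n => R n ω) P

/-- The (regular) conditional law of the request sequence given the hash function, evaluated at the
realized hash function. -/
noncomputable def requestLawGivenHash {Ω : Type*} [MeasurableSpace Ω] (P : Measure Ω)
    [IsFiniteMeasure P] {N : ℕ} (H : ℕ → Ω → Fin N) (R : ℤ → Ω → ℕ) (ω : Ω) : Measure (ℤ → ℕ) :=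
  condDistrib (fun ω n => R n ω) (fun ω i => H i ω) P (fun i => H i ω)

end LRUCluster

/-! Fix a set `A` of items with natural density `p > 0`. For every horizon `k`, a miss on `A` at
cache size `y` forces either that the item is absent from the last `k` requests ("fresh") or that
these contain at least `y` distinct items of `A`. Conversely, freshness together with more than `y`
distinct items of `A` forces a miss.

A layer-cake formula and dominated convergence show that the mean number of distinct items is
asymptotic to `a * k ^ (1 / α)` and the fresh probability to `(a / α) * k ^ (1 / α - 1)`, where `a =
p * c ^ (1 / α) * Γ(1 - 1 / α)`. With `k` close to `(θ * y / a) ^ α` the mean is about `θ * y`. For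
`θ ≠ 1` the deviation is exponentially unlikely, and letting `θ` approach `1` from either side gives
`y ^ (α - 1) * missProb → a ^ α / α` (`tendsto_missProb`). The deviation bound rests on
`lintegral_pow_distinctCount_le`: although the occurrences of different items are dependent, the
generating function of the distinct count is at most the Poisson one.

The limit depends on `A` only through the factor `p ^ α`. By the strong law, for almost every hash
function the items of server `m` have density `μ m`. The servers' contributions then add up to `∑ m,
μ m ^ α * b m ^ (1 - α)` times the single-cache constant, and the virtual size is the one that
produces the same factor. Independence identifies the conditional law of the requests with the
unconditional one. -/

namespace LRUCluster

/-! ### Zipf weights, level counts and natural density. -/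

/-- A non-increasing, positive probability vector with `q i ∼ c / (i + 1) ^ α`. -/
structure IsZipf (q : ℕ → ℝ) (α c : ℝ) : Prop where
  one_lt : 1 < α
  pos_const : 0 < c
  anti : Antitone q
  pos : ∀ i, 0 < q i
  hasSum : HasSum q 1
  tendsto : Tendsto (fun i : ℕ => q i / (c / ((i : ℝ) + 1) ^ α)) atTop (𝓝 1)

open Classical in
/-- The number of elements of `A` below `n`. -/
noncomputable def countBelow (A : Set ℕ) (n : ℕ) : ℕ := {i ∈ Finset.range n | i ∈ A}.card

/-- `A` has natural density `p`. -/
def HasDensity (A : Set ℕ) (p : ℝ) : Prop :=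
  Tendsto (fun n : ℕ => (countBelow A n : ℝ) / n) atTop (𝓝 p)

/-- The number of indices `i` with `s < q i`, for non-increasing `q`. -/
noncomputable def numAbove (q : ℕ → ℝ) (s : ℝ) : ℕ := sInf {n | q n ≤ s}

theorem countBelow_le (A : Set ℕ) (n : ℕ) : countBelow A n ≤ n := by
  classical
  exact (Finset.card_filter_le _ _).trans (Finset.card_range n).le

theorem countBelow_mono (A : Set ℕ) : Monotone (countBelow A) := by
  classical
  intro m n hmn
  have := Finset.card_le_card
    (Finset.filter_subset_filter (· ∈ A) (Finset.range_subset_range.2 hmn))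
  unfold countBelow
  convert this

theorem hasDensity_univ : HasDensity Set.univ 1 := by
  refine tendsto_const_nhds.congr' ?_
  filter_upwards [eventually_gt_atTop 0] with n hn
  have : (n : ℝ) ≠ 0 := by positivity
  simp [countBelow, this]

namespace IsZipf

variable {q : ℕ → ℝ} {α c : ℝ}

theorem le_one (h : IsZipf q α c) (i : ℕ) : q i ≤ 1 :=
  h.hasSum.tsum_eq ▸ h.hasSum.summable.le_tsum i fun j _ => (h.pos j).le

theorem tendsto_zero (h : IsZipf q α c) : Tendsto q atTop (𝓝 0) :=
  h.hasSum.summable.tendsto_atTop_zero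

theorem lt_numAbove_iff (h : IsZipf q α c) {s : ℝ} (hs : 0 < s) (i : ℕ) :
    i < numAbove q s ↔ s < q i := by
  have hne : {n | q n ≤ s}.Nonempty := by
    obtain ⟨n, hn⟩ := (h.tendsto_zero.eventually_lt_const hs).exists
    exact ⟨n, hn.le⟩
  constructor
  · intro hi
    by_contra! hle
    exact absurd (Nat.sInf_le (s := {n | q n ≤ s}) hle) (not_le.2 hi)
  · intro hi
    by_contra! hle
    have h1 : q (numAbove q s) ≤ s := Nat.sInf_mem hne
    linarith [h.anti hle]

theorem tendsto_mul_rpow (h : IsZipf q α c) :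
    Tendsto (fun i : ℕ => ((i : ℝ) + 1) * q i ^ (1 / α)) atTop (𝓝 (c ^ (1 / α))) := by
  have hα : 0 < α := by linarith [h.one_lt]
  have h1 : Tendsto (fun i : ℕ => (q i / (c / ((i : ℝ) + 1) ^ α)) ^ (1 / α)) atTop (𝓝 (1 ^ (1 / α))) :=
    h.tendsto.rpow_const (Or.inl one_ne_zero)
  have h2 := h1.mul_const (c ^ (1 / α))
  rw [Real.one_rpow, one_mul] at h2
  refine h2.congr fun i => ?_
  have hi : (0 : ℝ) < (i : ℝ) + 1 := by positivity
  have hc := h.pos_const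
  rw [← Real.mul_rpow (by have := h.pos i; positivity) hc.le]
  have : q i / (c / ((i : ℝ) + 1) ^ α) * c = ((i : ℝ) + 1) ^ α * q i := by field_simp
  rw [this, Real.mul_rpow (by positivity) (h.pos i).le, ← Real.rpow_mul hi.le,
    mul_one_div_cancel hα.ne', Real.rpow_one]

theorem tendsto_numAbove_atTop (h : IsZipf q α c) {s : ℕ → ℝ} (hs : ∀ k, 0 < s k)
    (hs0 : Tendsto s atTop (𝓝 0)) : Tendsto (fun k => numAbove q (s k)) atTop atTop := by
  refine tendsto_atTop.2 fun n => ?_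
  filter_upwards [hs0.eventually_lt_const (h.pos n)] with k hk
  exact ((h.lt_numAbove_iff (hs k) n).2 hk).le

theorem exists_numAbove_mul_rpow_le (h : IsZipf q α c) :
    ∃ C, 0 ≤ C ∧ ∀ s, 0 < s → (numAbove q s : ℝ) * s ^ (1 / α) ≤ C := by
  have hα : 0 < α := by linarith [h.one_lt]
  obtain ⟨C, hC⟩ := h.tendsto_mul_rpow.bddAbove_range
  have hC' : ∀ i : ℕ, ((i : ℝ) + 1) * q i ^ (1 / α) ≤ C := fun i => hC ⟨i, rfl⟩
  have hC0 : 0 ≤ C := le_trans (by have := h.pos 0; positivity) (hC' 0)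
  refine ⟨C, hC0, fun s hs => ?_⟩
  rcases hn : numAbove q s with _ | n
  · simpa using hC0
  · have : s < q n := (h.lt_numAbove_iff hs n).1 (by omega)
    refine le_trans ?_ (hC' n)
    push_cast
    gcongr

/-- Sandwich: the level count `n` satisfies `q n ≤ s < q (n - 1)`, and `n * q n ^ (1 / α)` and `n *
q (n - 1) ^ (1 / α)` have the same limit. -/
theorem tendsto_numAbove_mul_rpow (h : IsZipf q α c) {s : ℕ → ℝ} (hs : ∀ k, 0 < s k)
    (hs0 : Tendsto s atTop (𝓝 0)) :
    Tendsto (fun k => (numAbove q (s k) : ℝ) * s k ^ (1 / α)) atTop (𝓝 (c ^ (1 / α))) := by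
  have hα : 0 < α := by linarith [h.one_lt]
  have hN := h.tendsto_numAbove_atTop hs hs0
  have hup : Tendsto (fun n : ℕ => (n : ℝ) * q (n - 1) ^ (1 / α)) atTop (𝓝 (c ^ (1 / α))) := by
    rw [← tendsto_add_atTop_iff_nat 1]
    simpa using h.tendsto_mul_rpow
  have hlow : Tendsto (fun n : ℕ => (n : ℝ) * q n ^ (1 / α)) atTop (𝓝 (c ^ (1 / α))) := by
    have h0 : Tendsto (fun n : ℕ => q n ^ (1 / α)) atTop (𝓝 0) := by
      have := h.tendsto_zero.rpow_const (p := 1 / α) (Or.inr (by positivity))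
      rwa [Real.zero_rpow (by positivity)] at this
    have := h.tendsto_mul_rpow.sub h0
    rw [sub_zero] at this
    exact this.congr fun n => by ring
  refine tendsto_of_tendsto_of_tendsto_of_le_of_le' (hlow.comp hN) (hup.comp hN) ?_ ?_
  · refine Eventually.of_forall fun k => ?_
    have : q (numAbove q (s k)) ≤ s k :=
      not_lt.1 fun hlt => lt_irrefl _ ((h.lt_numAbove_iff (hs k) _).2 hlt)
    have h0 := (h.pos (numAbove q (s k))).le
    simp only [Function.comp]
    gcongr
  · filter_upwards [hN.eventually_gt_atTop 0] with k hk
    have : s k < q (numAbove q (s k) - 1) := (h.lt_numAbove_iff (hs k) _).1 (by omega)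
    have h0 := (hs k).le
    simp only [Function.comp]
    gcongr

theorem tendsto_countBelow_numAbove (h : IsZipf q α c) {A : Set ℕ} {p : ℝ} (hA : HasDensity A p)
    {s : ℕ → ℝ} (hs : ∀ k, 0 < s k) (hs0 : Tendsto s atTop (𝓝 0)) :
    Tendsto (fun k => (countBelow A (numAbove q (s k)) : ℝ) * s k ^ (1 / α)) atTop
      (𝓝 (p * c ^ (1 / α))) := by
  have hN := h.tendsto_numAbove_atTop hs hs0
  refine ((hA.comp hN).mul (h.tendsto_numAbove_mul_rpow hs hs0)).congr' ?_
  filter_upwards [hN.eventually_gt_atTop 0] with k hk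
  have : (numAbove q (s k) : ℝ) ≠ 0 := by positivity
  simp only [Function.comp]
  field_simp

/-! ### Layer cake and limits of sums over a set with density. -/

theorem tsum_indicator_layer (h : IsZipf q α c) (A : Set ℕ) {k v : ℝ} (hk : 0 < k) (hv : 0 < v)
    (y : ℝ) :
    ∑' i, A.indicator (fun i => (Set.Iio (k * q i)).indicator (fun _ => y) v) i =
      countBelow A (numAbove q (v / k)) * y := by
  classical
  have hmem : ∀ i, v < k * q i ↔ i < numAbove q (v / k) := fun i => by
    rw [h.lt_numAbove_iff (div_pos hv hk), div_lt_iff₀ hk, mul_comm]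
  rw [tsum_eq_sum (s := {i ∈ Finset.range (numAbove q (v / k)) | i ∈ A})]
  · rw [Finset.sum_congr rfl (g := fun _ => y), Finset.sum_const, nsmul_eq_mul, countBelow]
    · intro i hi
      simp only [Finset.mem_filter, Finset.mem_range] at hi
      rw [Set.indicator_of_mem hi.2, Set.indicator_of_mem (Set.mem_Iio.2 ((hmem i).2 hi.1))]
  · intro i hi
    simp only [Finset.mem_filter, Finset.mem_range, not_and] at hi
    by_cases hiA : i ∈ A
    · rw [Set.indicator_of_mem hiA, Set.indicator_of_notMem]
      exact fun hlt => hi ((hmem i).1 hlt) hiA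
    · rw [Set.indicator_of_notMem hiA]

/-- Layer cake formula. -/
theorem tsum_intervalIntegral_eq (h : IsZipf q α c) (A : Set ℕ) {k B : ℝ} (hk : 0 < k)
    {ψ : ℝ → ℝ} (hψ : Continuous ψ) (hB : ∀ v, 0 ≤ v → v ≤ k → |ψ v| ≤ B) :
    ∑' i, A.indicator (fun i => ∫ v in 0..k * q i, ψ v) i =
      ∫ v in Set.Ioi 0, countBelow A (numAbove q (v / k)) * ψ v := by
  set F : ℕ → ℝ → ℝ := fun i v =>
    A.indicator (fun i => (Set.Iio (k * q i)).indicator (fun _ => ψ v) v) i with hF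
  have hq0 : ∀ i, 0 ≤ k * q i := fun i => mul_nonneg hk.le (h.pos i).le
  have hset : ∀ i, Set.Iio (k * q i) ∩ Set.Ioi 0 = Set.Ioo 0 (k * q i) := fun i => by
    ext; simp [and_comm]
  have key : ∀ i (φ : ℝ → ℝ), ∫ v in Set.Ioi 0, (Set.Iio (k * q i)).indicator φ v =
      ∫ v in 0..k * q i, φ v := fun i φ => by
    rw [integral_indicator measurableSet_Iio, Measure.restrict_restrict measurableSet_Iio, hset,
      intervalIntegral.integral_of_le (hq0 i), integral_Ioc_eq_integral_Ioo]
  have hFi : ∀ i, i ∈ A → F i = (Set.Iio (k * q i)).indicator ψ := fun i hi => by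
    ext v
    simp [hF, hi, Set.indicator]
  have hFn : ∀ i, i ∉ A → F i = 0 := fun i hi => by
    ext v
    simp only [hF, Set.indicator_of_notMem hi, Pi.zero_apply]
  have hint : ∀ i, Integrable (F i) (volume.restrict (Set.Ioi 0)) := fun i => by
    by_cases hi : i ∈ A
    · rw [hFi i hi, integrable_indicator_iff measurableSet_Iio, IntegrableOn,
        Measure.restrict_restrict measurableSet_Iio, hset]
      exact (hψ.integrableOn_Icc (a := 0) (b := k * q i)).mono_set Set.Ioo_subset_Icc_self
    · rw [hFn i hi]
      exact integrable_zero _ _ _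
  have hB0 : 0 ≤ B := (abs_nonneg _).trans (hB 0 le_rfl hk.le)
  have hsum : Summable fun i => ∫ v in Set.Ioi 0, ‖F i v‖ := by
    refine Summable.of_nonneg_of_le (fun i => integral_nonneg fun v => norm_nonneg _) (fun i => ?_)
      (h.hasSum.summable.mul_left (B * k))
    by_cases hi : i ∈ A
    · simp only [hFi i hi, norm_indicator_eq_indicator_norm]
      rw [key i fun v => ‖ψ v‖]
      have := intervalIntegral.norm_integral_le_of_norm_le_const (a := 0) (b := k * q i) (C := B)
        (f := fun v => ‖ψ v‖) (fun v hv => by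
          rw [Set.uIoc_of_le (hq0 i)] at hv
          rw [norm_norm]
          exact hB v hv.1.le (hv.2.trans (by nlinarith [h.le_one i])))
      rw [sub_zero, abs_of_nonneg (hq0 i)] at this
      linarith [le_abs_self (∫ v in 0..k * q i, ‖ψ v‖), Real.norm_eq_abs (∫ v in 0..k * q i, ‖ψ v‖)]
    · simp only [hFn i hi, Pi.zero_apply, norm_zero, integral_zero]
      have := h.pos i
      positivity
  have := (hasSum_integral_of_summable_integral_norm hint hsum).tsum_eq
  rw [setIntegral_congr_fun measurableSet_Ioi
    (fun v hv => h.tsum_indicator_layer A hk hv (ψ v))] at this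
  rw [← this]
  refine tsum_congr fun i => ?_
  by_cases hi : i ∈ A
  · rw [Set.indicator_of_mem hi, hFi i hi, key]
  · simp [Set.indicator_of_notMem hi, hFn i hi]

/-- After layer cake, the factor `k ^ (-(1 / α))` turns the count at level `v / k` into
approximately `p * c ^ (1 / α) * v ^ (-(1 / α))`. The uniform bound on level counts gives an
integrable majorant, since `1 / α < 1`. -/
theorem tendsto_tsum_intervalIntegral (h : IsZipf q α c) {A : Set ℕ} {p : ℝ} (hA : HasDensity A p)
    {B : ℝ} {ψ : ℕ → ℝ → ℝ} {φ : ℝ → ℝ} (hψ : ∀ k, Continuous (ψ k))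
    (hB : ∀ᶠ k : ℕ in atTop, ∀ v : ℝ, 0 ≤ v → v ≤ k → |ψ k v| ≤ B * Real.exp (-(1 / 4) * v))
    (hlim : ∀ v, 0 < v → Tendsto (fun k => ψ k v) atTop (𝓝 (φ v))) :
    Tendsto (fun k : ℕ => (k : ℝ) ^ (-(1 / α)) *
        ∑' i, A.indicator (fun i => ∫ v in 0..k * q i, ψ k v) i) atTop
      (𝓝 (p * c ^ (1 / α) * ∫ v in Set.Ioi 0, v ^ (-(1 / α)) * φ v)) := by
  have hα : 0 < α := by linarith [h.one_lt]
  have hα1 : 1 / α < 1 := by rw [div_lt_one hα]; exact h.one_lt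
  obtain ⟨C, hC0, hC⟩ := h.exists_numAbove_mul_rpow_le
  have hev : ∀ᶠ k : ℕ in atTop, 0 < k ∧ ∀ v : ℝ, 0 ≤ v → v ≤ k →
    |ψ k v| ≤ B * Real.exp (-(1 / 4) * v) := (eventually_gt_atTop 0).and hB
  have hB0 : 0 ≤ B := by
    obtain ⟨k, hk0, hk⟩ := hev.exists
    simpa using (abs_nonneg _).trans (hk 0 le_rfl (Nat.cast_nonneg _))
  have hEq : (fun k : ℕ => (k : ℝ) ^ (-(1 / α)) *
      ∑' i, A.indicator (fun i => ∫ v in 0..k * q i, ψ k v) i) =ᶠ[atTop] fun k : ℕ =>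
      ∫ v in Set.Ioi 0, (k : ℝ) ^ (-(1 / α)) * (countBelow A (numAbove q (v / k)) * ψ k v) := by
    filter_upwards [hev] with k ⟨hk0, hk⟩
    rw [h.tsum_intervalIntegral_eq A (Nat.cast_pos.2 hk0) (hψ k) (B := B), integral_const_mul]
    intro v hv0 hv
    refine (hk v hv0 hv).trans (mul_le_of_le_one_right hB0 (Real.exp_le_one_iff.2 (by linarith)))
  rw [tendsto_congr' hEq, ← integral_const_mul]
  have hscale : ∀ (k : ℕ) (v : ℝ), 0 < k → 0 < v →
      (k : ℝ) ^ (-(1 / α)) = (v / k) ^ (1 / α) * v ^ (-(1 / α)) := fun k v hk hv => by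
    have hk' : (0 : ℝ) < k := Nat.cast_pos.2 hk
    rw [Real.div_rpow hv.le hk'.le, Real.rpow_neg hk'.le, Real.rpow_neg hv.le]
    have := (Real.rpow_pos_of_pos hv (1 / α)).ne'
    field_simp
  refine tendsto_integral_filter_of_dominated_convergence
    (fun v => C * B * (v ^ (-(1 / α)) * Real.exp (-(1 / 4) * v ^ (1 : ℝ)))) ?_ ?_ ?_ ?_
  · filter_upwards [hev] with k ⟨hk0, _⟩
    have hk' : (0 : ℝ) < k := Nat.cast_pos.2 hk0
    have hanti : AntitoneOn (fun v : ℝ => (countBelow A (numAbove q (v / k)) : ℝ)) (Set.Ioi 0) :=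
      fun v hv w hw hvw => Nat.cast_le.2 <| countBelow_mono A <| le_of_forall_lt fun i hi =>
        (h.lt_numAbove_iff (div_pos hv hk') i).2
          (((div_le_div_iff_of_pos_right hk').2 hvw).trans_lt
            ((h.lt_numAbove_iff (div_pos hw hk') i).1 hi))
    exact ((aemeasurable_restrict_of_antitoneOn measurableSet_Ioi hanti).aestronglyMeasurable.mul
      (hψ k).aestronglyMeasurable).const_mul _
  · filter_upwards [hev] with k ⟨hk0, hk⟩
    filter_upwards [ae_restrict_mem measurableSet_Ioi] with v hv
    have hv0 : 0 < v := hv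
    have hk' : (0 : ℝ) < k := Nat.cast_pos.2 hk0
    rw [Real.rpow_one, hscale k v hk0 hv0]
    rcases le_or_gt v k with hvk | hvk
    · have h1 := hk v hv0.le hvk
      have h2 := hC (v / k) (div_pos hv0 hk')
      have h3 : (countBelow A (numAbove q (v / k)) : ℝ) ≤ numAbove q (v / k) :=
        Nat.cast_le.2 (countBelow_le _ _)
      have h4 : 0 ≤ v ^ (-(1 / α)) := by positivity
      have h5 : 0 ≤ (v / k) ^ (1 / α) := by positivity
      rw [Real.norm_eq_abs, abs_mul, abs_mul, abs_mul, Nat.abs_cast, abs_of_nonneg h4,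
        abs_of_nonneg h5]
      calc (v / k) ^ (1 / α) * v ^ (-(1 / α)) * (countBelow A (numAbove q (v / k)) * |ψ k v|)
          = (countBelow A (numAbove q (v / k)) * (v / k) ^ (1 / α)) * |ψ k v| * v ^ (-(1 / α)) := by
            ring
        _ ≤ (numAbove q (v / k) * (v / k) ^ (1 / α)) * (B * Real.exp (-(1 / 4) * v)) *
              v ^ (-(1 / α)) := by gcongr
        _ ≤ C * (B * Real.exp (-(1 / 4) * v)) * v ^ (-(1 / α)) := by gcongr
        _ = _ := by ring
    -- No weight exceeds `1 < v / k`, so the integrand vanishes here; this is why `ψ k` needs a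
    -- bound only up to `k`.
    · have : numAbove q (v / k) = 0 := by
        by_contra hne
        have := (h.lt_numAbove_iff (div_pos hv0 hk') 0).1 (Nat.pos_of_ne_zero hne)
        have h1 : 1 < v / k := (one_lt_div hk').2 hvk
        linarith [h.le_one 0]
      have h0 : countBelow A 0 = 0 := Nat.le_zero.1 (countBelow_le A 0)
      rw [this, h0]
      simp only [Nat.cast_zero, zero_mul, mul_zero, norm_zero]
      positivity
  · exact ((integrableOn_rpow_mul_exp_neg_mul_rpow (by linarith) one_pos (by norm_num)).const_mul _)
  · filter_upwards [ae_restrict_mem measurableSet_Ioi] with v hv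
    have hv0 : 0 < v := hv
    have hs : ∀ k : ℕ, 0 < v / ((k : ℝ) + 1) := fun k => by positivity
    have hs0 : Tendsto (fun k : ℕ => v / ((k : ℝ) + 1)) atTop (𝓝 0) := by
      simpa using (tendsto_const_nhds (x := v)).div_atTop
        (tendsto_natCast_atTop_atTop.atTop_add (tendsto_const_nhds (x := (1 : ℝ))))
    -- The shift keeps the level `v / k` positive for every index, which fails at `k = 0`.
    rw [← tendsto_add_atTop_iff_nat 1]
    have h1 := ((h.tendsto_countBelow_numAbove hA hs hs0).mul_const (v ^ (-(1 / α)))).mul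
      ((tendsto_add_atTop_iff_nat 1).2 (hlim v hv0))
    rw [mul_assoc (p * c ^ (1 / α))] at h1
    refine h1.congr fun k => ?_
    rw [hscale (k + 1) v (Nat.succ_pos k) hv0]
    push_cast
    ring

end IsZipf

/-! ### Mean distinct count and fresh probability. -/

/-- The expected number of distinct items of `A` among `k` requests. -/
noncomputable def distinctMean (q : ℕ → ℝ) (A : Set ℕ) (k : ℕ) : ℝ :=
  ∑' i, A.indicator (fun i => 1 - (1 - q i) ^ k) i

/-- The probability that a request asks for an item of `A` that none of the `k` preceding requests
asked for. -/
noncomputable def freshProb (q : ℕ → ℝ) (A : Set ℕ) (k : ℕ) : ℝ :=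
  ∑' i, A.indicator (fun i => q i * (1 - q i) ^ k) i

theorem integral_one_sub_div_pow {k : ℕ} (hk : 0 < k) (x : ℝ) :
    ∫ v in (0 : ℝ)..k * x, (1 - v / k) ^ (k - 1) = 1 - (1 - x) ^ k := by
  have hk' : (k : ℝ) ≠ 0 := by positivity
  have hd : ∀ v : ℝ, HasDerivAt (fun v : ℝ => -(1 - v / k) ^ k) ((1 - v / k) ^ (k - 1)) v := by
    intro v
    have h1 : HasDerivAt (fun v : ℝ => 1 - v / k) (-(1 / k)) v :=
      ((hasDerivAt_id v).div_const (k : ℝ)).const_sub 1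
    refine (h1.pow k).neg.congr_deriv ?_
    field_simp
  rw [intervalIntegral.integral_eq_sub_of_hasDerivAt (fun v _ => hd v)
    (Continuous.intervalIntegrable (by fun_prop) _ _)]
  rw [mul_div_cancel_left₀ _ hk']
  simp
  ring

/-- The integrand is the derivative of `v * (1 - v / k) ^ k`; this puts the terms of `freshProb` in
layer-cake form. -/
theorem integral_one_sub_div_pow_mul {k : ℕ} (hk : 0 < k) (x : ℝ) :
    ∫ v in (0 : ℝ)..k * x, (1 - v / k) ^ (k - 1) * (1 - v - v / k) = k * (x * (1 - x) ^ k) := by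
  have hk' : (k : ℝ) ≠ 0 := by positivity
  have hd : ∀ v : ℝ, HasDerivAt (fun v : ℝ => v * (1 - v / k) ^ k)
      ((1 - v / k) ^ (k - 1) * (1 - v - v / k)) v := by
    intro v
    have h1 : HasDerivAt (fun v : ℝ => 1 - v / k) (-(1 / k)) v :=
      ((hasDerivAt_id v).div_const (k : ℝ)).const_sub 1
    refine ((hasDerivAt_id v).mul (h1.fun_pow k)).congr_deriv ?_
    obtain ⟨k, rfl⟩ : ∃ j, k = j + 1 := ⟨k - 1, by omega⟩
    simp only [id, Nat.add_sub_cancel, pow_succ]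
    field_simp
    ring
  rw [intervalIntegral.integral_eq_sub_of_hasDerivAt (fun v _ => hd v)
    (Continuous.intervalIntegrable (by fun_prop) _ _)]
  rw [mul_div_cancel_left₀ _ hk']
  ring

theorem one_sub_div_pow_le {k : ℕ} (hk : 2 ≤ k) {v : ℝ} (hv : 0 ≤ v) (hvk : v ≤ k) :
    (1 - v / k) ^ (k - 1) ≤ Real.exp (-(1 / 2) * v) := by
  have hk' : (2 : ℝ) ≤ k := by exact_mod_cast hk
  have h0 : 0 ≤ 1 - v / k := by
    rw [sub_nonneg, div_le_one (by linarith)]; exact hvk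
  calc (1 - v / k) ^ (k - 1) ≤ Real.exp (-(v / k)) ^ (k - 1) := by
        gcongr
        linarith [Real.add_one_le_exp (-(v / k))]
    _ = Real.exp ((k - 1 : ℕ) * -(v / k)) := (Real.exp_nat_mul _ _).symm
    _ ≤ _ := by
        rw [Real.exp_le_exp, Nat.cast_sub (by omega), Nat.cast_one]
        have : v / k ≤ v / 2 := by gcongr
        have h1 : (k : ℝ) * (v / k) = v := by field_simp
        nlinarith

theorem tendsto_one_sub_div_pow (v : ℝ) :
    Tendsto (fun k : ℕ => (1 - v / k) ^ (k - 1)) atTop (𝓝 (Real.exp (-v))) := by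
  have h1 := Real.tendsto_one_add_div_pow_exp (-v)
  have h2 : Tendsto (fun k : ℕ => 1 - v / k) atTop (𝓝 1) := by
    simpa using (tendsto_const_nhds (x := (1 : ℝ))).sub (tendsto_const_div_atTop_nhds_zero_nat v)
  have h3 := h1.div h2 one_ne_zero
  rw [div_one] at h3
  refine h3.congr' ?_
  filter_upwards [h2.eventually_ne one_ne_zero, eventually_gt_atTop 0] with k hk hk0
  obtain ⟨k, rfl⟩ : ∃ j, k = j + 1 := ⟨k - 1, by omega⟩
  rw [Pi.div_apply, div_eq_iff hk, Nat.add_sub_cancel, ← pow_succ]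
  congr 1
  ring

namespace IsZipf

variable {q : ℕ → ℝ} {α c : ℝ}

theorem integral_rpow_mul_exp (h : IsZipf q α c) :
    ∫ v in Set.Ioi 0, v ^ (-(1 / α)) * Real.exp (-v) = Real.Gamma (1 - 1 / α) := by
  have hα : 0 < α := by linarith [h.one_lt]
  have hα1 : 1 / α < 1 := by rw [div_lt_one hα]; exact h.one_lt
  rw [Real.Gamma_eq_integral (by linarith)]
  congr 1 with v
  rw [mul_comm]
  congr 2
  ring

/-- With `s = 1 - 1 / α`, the integral is `Γ(s) - Γ(s + 1) = (1 - s) * Γ(s)`. -/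
theorem integral_rpow_mul_exp_mul (h : IsZipf q α c) :
    ∫ v in Set.Ioi 0, v ^ (-(1 / α)) * (Real.exp (-v) * (1 - v)) =
      Real.Gamma (1 - 1 / α) / α := by
  have hα : 0 < α := by linarith [h.one_lt]
  have hα1 : 1 / α < 1 := by rw [div_lt_one hα]; exact h.one_lt
  have hs : 0 < 1 - 1 / α := by linarith
  have i1 := Real.GammaIntegral_convergent hs
  have i2 := Real.GammaIntegral_convergent (s := 1 - 1 / α + 1) (by linarith)
  have : Real.Gamma (1 - 1 / α) / α = Real.Gamma (1 - 1 / α) - Real.Gamma (1 - 1 / α + 1) := by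
    rw [Real.Gamma_add_one hs.ne']
    ring
  rw [this, Real.Gamma_eq_integral hs, Real.Gamma_eq_integral (by linarith),
    ← integral_sub i1 i2]
  refine setIntegral_congr_fun measurableSet_Ioi fun v hv => ?_
  have hv0 : 0 < v := hv
  have : v ^ (1 - 1 / α + 1 - 1) = v ^ (-(1 / α)) * v := by
    rw [← Real.rpow_add_one hv0.ne']
    congr 1
    ring
  simp only [this]
  rw [show (1 - 1 / α - 1) = -(1 / α) by ring]
  ring

theorem tendsto_distinctMean (h : IsZipf q α c) {A : Set ℕ} {p : ℝ} (hA : HasDensity A p) :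
    Tendsto (fun k : ℕ => (k : ℝ) ^ (-(1 / α)) * distinctMean q A k) atTop
      (𝓝 (p * c ^ (1 / α) * Real.Gamma (1 - 1 / α))) := by
  have := h.tendsto_tsum_intervalIntegral hA (ψ := fun k v => (1 - v / k) ^ (k - 1)) (B := 1)
    (φ := fun v => Real.exp (-v)) (fun k => by fun_prop) ?_ fun v _ => tendsto_one_sub_div_pow v
  · rw [h.integral_rpow_mul_exp] at this
    refine this.congr' ?_
    filter_upwards [eventually_gt_atTop 0] with k hk
    simp only [integral_one_sub_div_pow hk]
    rfl
  · filter_upwards [eventually_ge_atTop 2] with k hk v hv hvk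
    have h0 : 0 ≤ 1 - v / k := by
      rw [sub_nonneg, div_le_one (by positivity)]; exact hvk
    rw [abs_of_nonneg (by positivity), one_mul]
    refine (one_sub_div_pow_le hk hv hvk).trans (Real.exp_le_exp.2 (by linarith))

theorem tendsto_freshProb (h : IsZipf q α c) {A : Set ℕ} {p : ℝ} (hA : HasDensity A p) :
    Tendsto (fun k : ℕ => (k : ℝ) ^ (1 - 1 / α) * freshProb q A k) atTop
      (𝓝 (p * c ^ (1 / α) * Real.Gamma (1 - 1 / α) / α)) := by
  have := h.tendsto_tsum_intervalIntegral hA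
    (ψ := fun k v => (1 - v / k) ^ (k - 1) * (1 - v - v / k)) (B := 8)
    (φ := fun v => Real.exp (-v) * (1 - v)) (fun k => by fun_prop) ?_ fun v _ => ?_
  · rw [h.integral_rpow_mul_exp_mul, ← mul_div_assoc] at this
    refine this.congr' ?_
    filter_upwards [eventually_gt_atTop 0] with k hk
    have hk' : (0 : ℝ) < k := Nat.cast_pos.2 hk
    simp only [integral_one_sub_div_pow_mul hk]
    rw [sub_eq_neg_add, Real.rpow_add_one hk'.ne', freshProb, mul_assoc, ← tsum_mul_left (a := (k : ℝ))]
    congr 1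
    refine tsum_congr fun i => ?_
    by_cases hi : i ∈ A <;> simp [hi]
  · filter_upwards [eventually_ge_atTop 2] with k hk v hv hvk
    have hk' : (2 : ℝ) ≤ k := by exact_mod_cast hk
    have hvk1 : v / k ≤ 1 := by
      rw [div_le_one (by positivity)]; exact hvk
    have hvk0 : 0 ≤ v / k := by positivity
    have h0 : 0 ≤ 1 - v / k := by linarith
    rw [abs_mul, abs_of_nonneg (by positivity : 0 ≤ (1 - v / k) ^ (k - 1))]
    -- The linear factor uses up half of the decay rate `1 / 2`, leaving the required `1 / 4`.
    have h1 : |1 - v - v / k| ≤ 8 * Real.exp (1 / 4 * v) := by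
      have := Real.add_one_le_exp (1 / 4 * v)
      rw [abs_le]
      constructor <;> linarith
    calc _ ≤ Real.exp (-(1 / 2) * v) * (8 * Real.exp (1 / 4 * v)) := by
          gcongr
          exact one_sub_div_pow_le hk hv hvk
      _ = 8 * (Real.exp (-(1 / 2) * v) * Real.exp (1 / 4 * v)) := by ring
      _ = _ := by
          rw [← Real.exp_add]
          congr 2
          ring
  · refine (tendsto_one_sub_div_pow v).mul ?_
    simpa using (tendsto_const_nhds (x := 1 - v)).sub (tendsto_const_div_atTop_nhds_zero_nat v)

end IsZipf

/-! ### Inversion: from horizons `k` to cache sizes `y`. -/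

theorem tendsto_rpow_mul_exp_mul_zero {s l : ℝ} (hl : l < 0) {e : ℝ → ℝ}
    (he : Tendsto e atTop (𝓝 l)) :
    Tendsto (fun y : ℝ => y ^ s * Real.exp (y * e y)) atTop (𝓝 0) := by
  refine squeeze_zero' ?_ ?_ (tendsto_rpow_mul_exp_neg_mul_atTop_nhds_zero s (-l / 2) (by linarith))
  · filter_upwards [eventually_gt_atTop 0] with y hy
    positivity
  · filter_upwards [eventually_gt_atTop 0, he.eventually_lt_const (by linarith : l < l / 2)]
      with y hy hly
    exact mul_le_mul_of_nonneg_left (Real.exp_le_exp.2 (by nlinarith)) (by positivity)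

section Inversion

variable {α a : ℝ} {F G : ℕ → ℝ}

theorem tendsto_floor_div_rpow (hα : 0 < α) {t : ℝ} (ht : 0 ≤ t) :
    Tendsto (fun y : ℝ => (⌊t * y ^ α⌋₊ : ℝ) / y ^ α) atTop (𝓝 t) :=
  (tendsto_nat_floor_mul_div_atTop ht).comp (tendsto_rpow_atTop hα)

theorem tendsto_floor_mul_rpow_atTop (hα : 0 < α) {t : ℝ} (ht : 0 < t) :
    Tendsto (fun y : ℝ => ⌊t * y ^ α⌋₊) atTop atTop :=
  tendsto_nat_floor_atTop.comp ((tendsto_rpow_atTop hα).const_mul_atTop ht)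

/-- The horizon is chosen so that the mean distinct count is about `θ * y`. -/
theorem tendsto_mean_div (hα : 0 < α) (ha : 0 < a)
    (hG : Tendsto (fun k : ℕ => (k : ℝ) ^ (-(1 / α)) * G k) atTop (𝓝 a)) {θ : ℝ} (hθ : 0 < θ) :
    Tendsto (fun y : ℝ => G ⌊(θ / a) ^ α * y ^ α⌋₊ / y) atTop (𝓝 θ) := by
  have ht : 0 < (θ / a) ^ α := by positivity
  have hk := tendsto_floor_mul_rpow_atTop hα ht
  have h1 := (hG.comp hk).mul
    ((tendsto_floor_div_rpow hα ht.le).rpow_const (p := 1 / α) (Or.inl ht.ne'))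
  rw [← Real.rpow_mul (by positivity), mul_one_div_cancel hα.ne', Real.rpow_one,
    mul_div_cancel₀ _ ha.ne'] at h1
  refine h1.congr' ?_
  filter_upwards [hk.eventually_gt_atTop 0, eventually_gt_atTop 0] with y hky hy
  have hky' : (0 : ℝ) < ⌊(θ / a) ^ α * y ^ α⌋₊ := Nat.cast_pos.2 hky
  simp only [Function.comp]
  rw [Real.div_rpow hky'.le (by positivity), ← Real.rpow_mul hy.le, mul_one_div_cancel hα.ne',
    Real.rpow_one, Real.rpow_neg hky'.le]
  have := (Real.rpow_pos_of_pos hky' (1 / α)).ne'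
  field_simp

theorem tendsto_rpow_mul_fresh (hα : 0 < α) (ha : 0 < a)
    (hF : Tendsto (fun k : ℕ => (k : ℝ) ^ (1 - 1 / α) * F k) atTop (𝓝 (a / α))) {θ : ℝ}
    (hθ : 0 < θ) :
    Tendsto (fun y : ℝ => y ^ (α - 1) * F ⌊(θ / a) ^ α * y ^ α⌋₊) atTop
      (𝓝 (a / α * (θ / a) ^ (1 - α))) := by
  have ht : 0 < (θ / a) ^ α := by positivity
  have hk := tendsto_floor_mul_rpow_atTop hα ht
  have h1 := (hF.comp hk).mul
    ((tendsto_floor_div_rpow hα ht.le).rpow_const (p := -(1 - 1 / α)) (Or.inl ht.ne'))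
  have e : α * -(1 - 1 / α) = 1 - α := by field_simp; ring
  rw [← Real.rpow_mul (by positivity), e] at h1
  refine h1.congr' ?_
  filter_upwards [hk.eventually_gt_atTop 0, eventually_gt_atTop 0] with y hky hy
  have hky' : (0 : ℝ) < ⌊(θ / a) ^ α * y ^ α⌋₊ := Nat.cast_pos.2 hky
  simp only [Function.comp]
  rw [Real.div_rpow hky'.le (by positivity), ← Real.rpow_mul hy.le, e, Real.rpow_neg hky'.le,
    ← neg_sub α 1, Real.rpow_neg hy.le]
  have := (Real.rpow_pos_of_pos hky' (1 - 1 / α)).ne'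
  have := (Real.rpow_pos_of_pos hy (α - 1)).ne'
  field_simp

/-- The value `z = 1 / θ - 1` minimizes `exp (z * θ * y) * (1 + z) ^ (-y)`. The exponent is then
about `y * (1 - θ + log θ)`, negative for `θ ≠ 1`, so it beats the polynomial factor. -/
theorem tendsto_rpow_mul_chernoff (hα : 0 < α) (ha : 0 < a)
    (hG : Tendsto (fun k : ℕ => (k : ℝ) ^ (-(1 / α)) * G k) atTop (𝓝 a)) {θ : ℝ} (hθ : 0 < θ)
    (hθ1 : θ ≠ 1) :
    Tendsto (fun y : ℝ => y ^ (α - 1) * (Real.exp ((1 / θ - 1) * G ⌊(θ / a) ^ α * y ^ α⌋₊) *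
      (1 + (1 / θ - 1)) ^ (-y))) atTop (𝓝 0) := by
  have h1 := ((tendsto_mean_div hα ha hG hθ).const_mul (1 / θ - 1)).add_const (Real.log θ)
  have hl : (1 / θ - 1) * θ + Real.log θ < 0 := by
    have := Real.log_lt_sub_one_of_pos hθ hθ1
    have e : (1 / θ - 1) * θ = 1 - θ := by field_simp
    linarith
  refine (tendsto_rpow_mul_exp_mul_zero (s := α - 1) hl h1).congr' ?_
  filter_upwards [eventually_gt_atTop 0] with y hy
  have e : 1 + (1 / θ - 1) = θ⁻¹ := by rw [one_div]; ring
  rw [e, Real.rpow_neg (by positivity), Real.inv_rpow hθ.le, inv_inv, Real.rpow_def_of_pos hθ,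
    ← Real.exp_add]
  congr 2
  field_simp

/-- A `θ < 1` makes `z > 0` and serves the upper bound; a `θ > 1` makes `-1 < z < 0` and serves the
lower one. The main term is continuous in `θ` at `1`. -/
theorem tendsto_rpow_mul_of_chernoff_sandwich (hα : 0 < α) (ha : 0 < a) {M : ℝ → ℝ}
    (hG : Tendsto (fun k : ℕ => (k : ℝ) ^ (-(1 / α)) * G k) atTop (𝓝 a))
    (hF : Tendsto (fun k : ℕ => (k : ℝ) ^ (1 - 1 / α) * F k) atTop (𝓝 (a / α)))
    (hup : ∀ y z k, 0 < y → 0 ≤ z → M y ≤ F k + Real.exp (z * G k) * (1 + z) ^ (-y))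
    (hlow : ∀ y z k, 0 < y → -1 < z → z ≤ 0 → F k - Real.exp (z * G k) * (1 + z) ^ (-y) ≤ M y) :
    Tendsto (fun y : ℝ => y ^ (α - 1) * M y) atTop (𝓝 (a ^ α / α)) := by
  have hL : Tendsto (fun θ : ℝ => a / α * (θ / a) ^ (1 - α)) (𝓝 1) (𝓝 (a ^ α / α)) := by
    have e : a ^ α / α = a / α * (1 / a) ^ (1 - α) := by
      rw [one_div, Real.inv_rpow ha.le, ← Real.rpow_neg ha.le, neg_sub, Real.rpow_sub_one ha.ne']
      field_simp
    rw [e]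
    refine (ContinuousAt.rpow_const ?_ (Or.inl (by positivity))).const_mul (a / α)
    fun_prop
  have hpos : ∀ᶠ θ : ℝ in 𝓝 1, 0 < θ := lt_mem_nhds one_pos
  refine tendsto_order.2 ⟨fun l hl => ?_, fun u hu => ?_⟩
  · obtain ⟨θ, ⟨hlθ, hθ⟩, hθ1 : 1 < θ⟩ := (((hL.eventually_const_lt hl).and hpos).filter_mono
      nhdsWithin_le_nhds |>.and (self_mem_nhdsWithin (s := Set.Ioi 1))).exists
    have h1 := (tendsto_rpow_mul_fresh hα ha hF hθ).sub
      (tendsto_rpow_mul_chernoff hα ha hG hθ hθ1.ne')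
    rw [sub_zero] at h1
    filter_upwards [h1.eventually_const_lt hlθ, eventually_gt_atTop 0] with y hy hy0
    refine hy.trans_le ?_
    rw [← mul_sub]
    have : 1 / θ ≤ 1 := (div_le_one hθ).2 hθ1.le
    have : 0 < 1 / θ := by positivity
    gcongr
    exact hlow y _ _ hy0 (by linarith) (by linarith)
  · obtain ⟨θ, ⟨hlθ, hθ⟩, hθ1 : θ < 1⟩ := (((hL.eventually_lt_const hu).and hpos).filter_mono
      nhdsWithin_le_nhds |>.and (self_mem_nhdsWithin (s := Set.Iio 1))).exists
    have h1 := (tendsto_rpow_mul_fresh hα ha hF hθ).add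
      (tendsto_rpow_mul_chernoff hα ha hG hθ hθ1.ne)
    rw [add_zero] at h1
    filter_upwards [h1.eventually_lt_const hlθ, eventually_gt_atTop 0] with y hy hy0
    refine lt_of_le_of_lt ?_ hy
    rw [← mul_add]
    have : 1 ≤ 1 / θ := (one_le_div hθ).2 hθ1.le
    gcongr
    exact hup y _ _ hy0 (by linarith)

end Inversion

/-! ### Distinct counts and their exponential moments. -/

/-- The items of `A` among `x 1, …, x k`. -/
def distinctItems (A : Set ℕ) (k : ℕ) (x : ℕ → ℕ) : Set ℕ :=
  {e | e ∈ A ∧ ∃ j < k, x (j + 1) = e}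

theorem finite_distinctItems (A : Set ℕ) (k : ℕ) (x : ℕ → ℕ) : (distinctItems A k x).Finite :=
  ((Set.finite_lt_nat k).image fun j => x (j + 1)).subset fun _ ⟨_, j, hj, hx⟩ => ⟨j, hj, hx⟩

/-- The number of distinct items of `A` among `x 1, …, x k`. -/
noncomputable def distinctCount (A : Set ℕ) (k : ℕ) (x : ℕ → ℕ) : ℕ := (distinctItems A k x).ncard

open Classical in
-- Deleting the last item from `A` avoids asking whether it occurred earlier: once its value is
-- fixed, the remaining count depends only on the first `k` requests.
theorem distinctCount_succ (A : Set ℕ) (k : ℕ) (x : ℕ → ℕ) :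
    distinctCount A (k + 1) x =
      distinctCount (A \ {x (k + 1)}) k x + if x (k + 1) ∈ A then 1 else 0 := by
  unfold distinctCount
  split_ifs with hA
  · have h1 : distinctItems A (k + 1) x =
        insert (x (k + 1)) (distinctItems (A \ {x (k + 1)}) k x) := by
      ext e
      constructor
      · rintro ⟨he, j, hj, rfl⟩
        by_cases hx : x (j + 1) = x (k + 1)
        · exact Or.inl hx
        · refine Or.inr ⟨⟨he, hx⟩, j, lt_of_le_of_ne (Nat.lt_succ_iff.1 hj) ?_, rfl⟩
          rintro rfl
          exact hx rfl
      · rintro (rfl | ⟨he, j, hj, hx⟩)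
        · exact ⟨hA, k, k.lt_succ_self, rfl⟩
        · exact ⟨he.1, j, hj.trans k.lt_succ_self, hx⟩
    rw [h1, Set.ncard_insert_of_notMem (fun hx => hx.1.2 rfl) (finite_distinctItems _ _ _)]
  · rw [Set.sdiff_singleton_eq_self hA, add_zero]
    congr 1
    ext e
    constructor
    · rintro ⟨he, j, hj, hx⟩
      refine ⟨he, j, lt_of_le_of_ne (Nat.lt_succ_iff.1 hj) ?_, hx⟩
      rintro rfl
      exact hA (hx ▸ he)
    · rintro ⟨he, j, hj, hx⟩
      exact ⟨he, j, hj.trans k.lt_succ_self, hx⟩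

theorem distinctCount_congr (A : Set ℕ) (k : ℕ) {x y : ℕ → ℕ}
    (h : ∀ j < k, x (j + 1) = y (j + 1)) : distinctCount A k x = distinctCount A k y := by
  have : distinctItems A k x = distinctItems A k y := by
    ext e
    exact and_congr_right fun _ => exists_congr fun j => and_congr_right fun hj => by rw [h j hj]
  simp only [distinctCount, this]

/-- Convexity of `exp` bounds `exp (-(z * t))` by its chord on `0 ≤ t ≤ 1`, and `(1 + z) * exp (-z)
≤ 1` handles the endpoint. Both signs of `z` are covered. -/
theorem one_add_mul_exp_neg_le {z t : ℝ} (hz : -1 < z) (ht0 : 0 ≤ t) (ht1 : t ≤ 1) :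
    (1 + z) * Real.exp (-(z * t)) ≤ 1 + z * (1 - t) := by
  have h1 := convexOn_exp.2 (Set.mem_univ 0) (Set.mem_univ (-z)) (sub_nonneg.2 ht1) ht0 (by ring)
  simp only [smul_eq_mul, mul_zero, zero_add, Real.exp_zero, mul_one] at h1
  have h2 : (1 + z) * Real.exp (-z) ≤ 1 := by
    rw [Real.exp_neg, ← div_eq_mul_inv, div_le_one (Real.exp_pos z)]
    linarith [Real.add_one_le_exp z]
  have e : t * -z = -(z * t) := by ring
  rw [e] at h1
  nlinarith

namespace IsZipf

variable {q : ℕ → ℝ} {α c : ℝ}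

theorem one_sub_pow_mem (h : IsZipf q α c) (i k : ℕ) :
    0 ≤ (1 - q i) ^ k ∧ (1 - q i) ^ k ≤ 1 := by
  have h0 := h.pos i
  have h1 := h.le_one i
  exact ⟨pow_nonneg (by linarith) k, pow_le_one₀ (by linarith) (by linarith)⟩

theorem summable_distinctMean (h : IsZipf q α c) (A : Set ℕ) (k : ℕ) :
    Summable (A.indicator fun i => 1 - (1 - q i) ^ k) := by
  refine Summable.indicator (Summable.of_nonneg_of_le
    (fun i => sub_nonneg.2 (h.one_sub_pow_mem i k).2) (fun i => ?_)
    (h.hasSum.summable.mul_left (k : ℝ))) A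
  have h1 := h.le_one i
  have := one_add_mul_le_pow (a := -q i) (by linarith) k
  rw [← sub_eq_add_neg] at this
  linarith

theorem summable_freshProb (h : IsZipf q α c) (A : Set ℕ) (k : ℕ) :
    Summable (A.indicator fun i => q i * (1 - q i) ^ k) :=
  (Summable.of_nonneg_of_le
    (fun i => mul_nonneg (h.pos i).le (h.one_sub_pow_mem i k).1)
    (fun i => mul_le_of_le_one_right (h.pos i).le (h.one_sub_pow_mem i k).2)
    h.hasSum.summable).indicator A

theorem distinctMean_succ (h : IsZipf q α c) (A : Set ℕ) (k : ℕ) :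
    distinctMean q A (k + 1) = distinctMean q A k + freshProb q A k := by
  rw [distinctMean, distinctMean, freshProb,
    ← (h.summable_distinctMean A k).tsum_add (h.summable_freshProb A k)]
  refine tsum_congr fun i => ?_
  by_cases hi : i ∈ A
  · simp only [Set.indicator_of_mem hi]
    ring
  · simp [hi]

open Classical in
theorem distinctMean_diff_singleton (h : IsZipf q α c) (A : Set ℕ) (k i : ℕ) :
    distinctMean q (A \ {i}) k =
      distinctMean q A k - if i ∈ A then 1 - (1 - q i) ^ k else 0 := by
  rw [eq_sub_iff_add_eq, distinctMean, distinctMean,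
    ← tsum_ite_eq i (fun _ => if i ∈ A then 1 - (1 - q i) ^ k else 0),
    ← (h.summable_distinctMean (A \ {i}) k).tsum_add (hasSum_ite_eq i _).summable]
  refine tsum_congr fun j => ?_
  by_cases hj : j ∈ A <;> by_cases hij : j = i <;> simp_all [Set.indicator]

open Classical in
-- Induction step for the exponential moment, conditioning on the last request. The chord inequality
-- with `t = 1 - (1 - q i) ^ k` makes the sum at most `exp (z * distinctMean q A k) * (1 + z *
-- freshProb q A k)`, and `1 + u ≤ exp u` closes it because `freshProb` is the increment of the
-- mean.
theorem tsum_conditioned_le (h : IsZipf q α c) (A : Set ℕ) (k : ℕ) {z : ℝ} (hz : -1 < z) :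
    ∑' i, ENNReal.ofReal (q i) * (ENNReal.ofReal ((1 + z) ^ (if i ∈ A then 1 else 0)) *
        ENNReal.ofReal (Real.exp (z * distinctMean q (A \ {i}) k))) ≤
      ENNReal.ofReal (Real.exp (z * distinctMean q A (k + 1))) := by
  set E := Real.exp (z * distinctMean q A k) with hE
  have hE0 : 0 < E := Real.exp_pos _
  have hz' : 0 ≤ 1 + z := by linarith
  set u : ℕ → ℝ := fun i => q i + z * A.indicator (fun i => q i * (1 - q i) ^ k) i with hu
  have hterm : ∀ i, q i * ((1 + z) ^ (if i ∈ A then 1 else 0) *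
      Real.exp (z * distinctMean q (A \ {i}) k)) ≤ E * u i := fun i => by
    rw [h.distinctMean_diff_singleton]
    have hq := h.pos i
    by_cases hi : i ∈ A
    · simp only [hi, if_true, pow_one, hu, Set.indicator_of_mem]
      have hm := h.one_sub_pow_mem i k
      have h1 := one_add_mul_exp_neg_le (t := 1 - (1 - q i) ^ k) hz (by linarith) (by linarith)
      rw [mul_sub, sub_eq_add_neg, Real.exp_add, ← hE]
      calc _ = E * q i * ((1 + z) * Real.exp (-(z * (1 - (1 - q i) ^ k)))) := by ring
        _ ≤ E * q i * (1 + z * (1 - (1 - (1 - q i) ^ k))) := by gcongr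
        _ = _ := by ring
    · simp only [hi, if_false, hu, Set.indicator_of_notMem, not_false_eq_true, sub_zero, pow_zero,
        ← hE]
      exact (by ring : q i * (1 * E) = E * (q i + z * 0)).le
  have hu0 : ∀ i, 0 ≤ E * u i := fun i =>
    le_trans (by have := h.pos i; positivity) (hterm i)
  have hS : HasSum (fun i => E * u i) (E * (1 + z * freshProb q A k)) :=
    (h.hasSum.add ((h.summable_freshProb A k).hasSum.mul_left z)).mul_left E
  calc _ ≤ ∑' i, ENNReal.ofReal (E * u i) := by
        refine ENNReal.tsum_le_tsum fun i => ?_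
        rw [← ENNReal.ofReal_mul (by positivity), ← ENNReal.ofReal_mul (h.pos i).le]
        exact ENNReal.ofReal_le_ofReal (hterm i)
    _ = ENNReal.ofReal (E * (1 + z * freshProb q A k)) := by
        rw [← ENNReal.ofReal_tsum_of_nonneg hu0 hS.summable, hS.tsum_eq]
    _ ≤ _ := by
        refine ENNReal.ofReal_le_ofReal ?_
        rw [h.distinctMean_succ, mul_add z, Real.exp_add]
        gcongr
        linarith [Real.add_one_le_exp (z * freshProb q A k)]

end IsZipf

section Iid

variable {Ω : Type*} [MeasurableSpace Ω] {P : Measure Ω} {q : ℕ → ℝ} {α c : ℝ} {X : ℕ → Ω → ℕ}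

theorem exists_distinctCount_eq_comp (A : Set ℕ) (k : ℕ) :
    ∃ D : (Finset.Icc 1 k → ℕ) → ℕ, ∀ x : ℕ → ℕ,
      distinctCount A k x = D fun j => x j := by
  classical
  refine ⟨fun y => distinctCount A k fun n => if hn : n ∈ Finset.Icc 1 k then y ⟨n, hn⟩ else 0,
    fun x => distinctCount_congr A k fun j hj => ?_⟩
  have : j + 1 ∈ Finset.Icc 1 k := Finset.mem_Icc.2 ⟨by omega, by omega⟩
  rw [dif_pos this]

theorem measurable_distinctCount (hX : ∀ n, Measurable (X n)) (A : Set ℕ) (k : ℕ) :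
    Measurable fun ω => distinctCount A k fun n => X n ω := by
  obtain ⟨D, hD⟩ := exists_distinctCount_eq_comp A k
  simp only [hD]
  exact (Measurable.of_discrete (f := D)).comp (measurable_pi_lambda (fun ω (j : Finset.Icc 1 k) => X j ω) fun j => hX j)

theorem setLIntegral_distinctCount (hX : ∀ n, Measurable (X n)) (hind : iIndepFun X P)
    (A : Set ℕ) (k i : ℕ) (f : ℕ → ℝ≥0∞) :
    ∫⁻ ω in X (k + 1) ⁻¹' {i}, f (distinctCount A k fun n => X n ω) ∂P =
      P (X (k + 1) ⁻¹' {i}) * ∫⁻ ω, f (distinctCount A k fun n => X n ω) ∂P := by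
  obtain ⟨D, hD⟩ := exists_distinctCount_eq_comp A k
  have hI := hind.indepFun_finset {k + 1} (Finset.Icc 1 k) (by simp) hX
  have hI2 := hI.comp
    (φ := fun y => ({i} : Set ℕ).indicator (fun _ => (1 : ℝ≥0∞)) (y ⟨k + 1, by simp⟩))
    (ψ := fun y => f (D y)) (Measurable.of_discrete) (Measurable.of_discrete)
  have hm : MeasurableSet (X (k + 1) ⁻¹' {i}) := hX _ (measurableSet_singleton i)
  have h1 := lintegral_mul_eq_lintegral_mul_lintegral_of_indepFun
    (f := (X (k + 1) ⁻¹' {i}).indicator fun _ => (1 : ℝ≥0∞))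
    (g := fun ω => f (distinctCount A k fun n => X n ω)) (measurable_const.indicator hm)
    (Measurable.of_discrete.comp (measurable_distinctCount hX A k)) (by
      simp only [hD]
      exact hI2)
  rw [lintegral_indicator_const hm, one_mul] at h1
  rw [← h1, ← lintegral_indicator hm]
  refine lintegral_congr fun ω => ?_
  by_cases hω : ω ∈ X (k + 1) ⁻¹' {i} <;> simp [Set.indicator, hω]

/-- The induction must run over all `A` at once, since conditioning on the last request replaces `A`
by `A \ {i}`. -/
theorem lintegral_pow_distinctCount_le [IsProbabilityMeasure P] (h : IsZipf q α c)
    (hX : ∀ n, Measurable (X n)) (hind : iIndepFun X P)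
    (hlaw : ∀ n i, P (X n ⁻¹' {i}) = ENNReal.ofReal (q i)) {z : ℝ} (hz : -1 < z) (k : ℕ) :
    ∀ A : Set ℕ, ∫⁻ ω, ENNReal.ofReal ((1 + z) ^ distinctCount A k fun n => X n ω) ∂P ≤
      ENNReal.ofReal (Real.exp (z * distinctMean q A k)) := by
  classical
  have hz' : 0 ≤ 1 + z := by linarith
  induction k with
  | zero => intro A; simp [distinctCount, distinctItems, distinctMean]
  | succ k ih =>
    intro A
    have hsplit : ∫⁻ ω, ENNReal.ofReal ((1 + z) ^ distinctCount A (k + 1) fun n => X n ω) ∂P =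
        ∑' i, ∫⁻ ω in X (k + 1) ⁻¹' {i},
          ENNReal.ofReal ((1 + z) ^ distinctCount A (k + 1) fun n => X n ω) ∂P := by
      rw [← lintegral_iUnion (fun i => hX _ (measurableSet_singleton i))
        (fun i j hij => Disjoint.preimage _ (by simpa using hij)), ← Set.preimage_iUnion,
        Set.iUnion_of_singleton, Set.preimage_univ, setLIntegral_univ]
    refine hsplit.trans_le (le_trans (ENNReal.tsum_le_tsum fun i => ?_)
      (h.tsum_conditioned_le A k hz))
    · have hm : MeasurableSet (X (k + 1) ⁻¹' {i}) := hX _ (measurableSet_singleton i)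
      have hmeas : Measurable fun ω =>
          ENNReal.ofReal ((1 + z) ^ distinctCount (A \ {i}) k fun n => X n ω) :=
        (Measurable.of_discrete (f := fun d : ℕ => ENNReal.ofReal ((1 + z) ^ d))).comp
          (measurable_distinctCount hX (A \ {i}) k)
      rw [setLIntegral_congr_fun (g := fun ω =>
        ENNReal.ofReal ((1 + z) ^ (if i ∈ A then 1 else 0)) *
          ENNReal.ofReal ((1 + z) ^ distinctCount (A \ {i}) k fun n => X n ω)) hm,
        lintegral_const_mul _ hmeas,
        setLIntegral_distinctCount hX hind (A \ {i}) k i fun d => ENNReal.ofReal ((1 + z) ^ d),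
        hlaw, mul_left_comm]
      · gcongr
        exact ih _
      · intro ω hω
        have hω' : X (k + 1) ω = i := hω
        simp only [distinctCount_succ, hω']
        rw [← ENNReal.ofReal_mul (by positivity), ← pow_add, add_comm (distinctCount _ _ _)]

/-- Markov's inequality. Comparing powers of `1 + z` serves both tails: the upper one for `z ≥ 0`,
the lower one for `z ≤ 0`. -/
theorem measureReal_le_of_pow_ge [IsProbabilityMeasure P] (h : IsZipf q α c)
    (hX : ∀ n, Measurable (X n)) (hind : iIndepFun X P)
    (hlaw : ∀ n i, P (X n ⁻¹' {i}) = ENNReal.ofReal (q i)) {z : ℝ} (hz : -1 < z) (k : ℕ)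
    (A : Set ℕ) {y : ℝ} {S : Set Ω}
    (hS : ∀ ω ∈ S, (1 + z) ^ y ≤ (1 + z) ^ distinctCount A k fun n => X n ω) :
    P.real S ≤ Real.exp (z * distinctMean q A k) * (1 + z) ^ (-y) := by
  have hz' : 0 < 1 + z := by linarith
  have hy := Real.rpow_pos_of_pos hz' y
  have h1 : ENNReal.ofReal ((1 + z) ^ y) * P S ≤
      ENNReal.ofReal (Real.exp (z * distinctMean q A k)) := by
    refine le_trans ?_ (lintegral_pow_distinctCount_le h hX hind hlaw hz k A)
    refine le_trans ?_ (mul_meas_ge_le_lintegral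
      ((Measurable.of_discrete (f := fun d : ℕ => ENNReal.ofReal ((1 + z) ^ d))).comp
        (measurable_distinctCount hX A k)) (ENNReal.ofReal ((1 + z) ^ y)))
    exact mul_le_mul_right (measure_mono fun ω hω => ENNReal.ofReal_le_ofReal (hS ω hω)) _
  have h2 := ENNReal.toReal_mono ENNReal.ofReal_ne_top h1
  rw [ENNReal.toReal_mul, ENNReal.toReal_ofReal hy.le, ENNReal.toReal_ofReal (Real.exp_pos _).le]
    at h2
  rw [Real.rpow_neg hz'.le, ← div_eq_mul_inv, le_div_iff₀ hy, mul_comm]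
  exact h2

theorem measureReal_fresh [IsProbabilityMeasure P] (h : IsZipf q α c)
    (hX : ∀ n, Measurable (X n)) (hind : iIndepFun X P)
    (hlaw : ∀ n i, P (X n ⁻¹' {i}) = ENNReal.ofReal (q i)) (A : Set ℕ) (k : ℕ) :
    P.real {ω | X 0 ω ∈ A ∧ ∀ j < k, X (j + 1) ω ≠ X 0 ω} = freshProb q A k := by
  have hi : ∀ i, P (⋂ n ∈ Finset.range (k + 1), X n ⁻¹' (if n = 0 then {i} else {i}ᶜ)) =
      ENNReal.ofReal (q i * (1 - q i) ^ k) := fun i => by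
    rw [hind.measure_inter_preimage_eq_mul _ fun n _ => MeasurableSet.of_discrete,
      Finset.prod_range_succ', if_pos rfl, hlaw]
    have : ∀ j : ℕ, P (X (j + 1) ⁻¹' (if j + 1 = 0 then {i} else {i}ᶜ)) =
        ENNReal.ofReal (1 - q i) := fun j => by
      rw [if_neg (Nat.succ_ne_zero j), Set.preimage_compl,
        prob_compl_eq_one_sub (hX _ (measurableSet_singleton i)), hlaw,
        ENNReal.ofReal_sub _ (h.pos i).le, ENNReal.ofReal_one]
    simp only [this, Finset.prod_const, Finset.card_range]
    rw [mul_comm, ENNReal.ofReal_mul (h.pos i).le, ENNReal.ofReal_pow (by linarith [h.le_one i])]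
  have hU : {ω | X 0 ω ∈ A ∧ ∀ j < k, X (j + 1) ω ≠ X 0 ω} = ⋃ i : A,
      ⋂ n ∈ Finset.range (k + 1), X n ⁻¹' (if n = 0 then {(i : ℕ)} else {(i : ℕ)}ᶜ) := by
    ext ω
    simp only [Set.mem_ofPred_eq, Set.mem_iUnion, Set.mem_iInter, Finset.mem_range, Set.mem_preimage]
    constructor
    · rintro ⟨h0, h1⟩
      refine ⟨⟨_, h0⟩, fun n hn => ?_⟩
      rcases n with _ | n
      · simp
      · simpa using h1 n (by omega)
    · rintro ⟨i, hi⟩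
      have h0 : X 0 ω = i := by simpa using hi 0 (by omega)
      refine ⟨h0 ▸ i.2, fun j hj => ?_⟩
      rw [h0]
      simpa using hi (j + 1) (by omega)
  rw [hU, measureReal_def, measure_iUnion]
  · simp only [hi]
    rw [tsum_subtype A fun i => ENNReal.ofReal (q i * (1 - q i) ^ k), freshProb]
    have e : A.indicator (fun i => ENNReal.ofReal (q i * (1 - q i) ^ k)) =
        fun i => ENNReal.ofReal (A.indicator (fun i => q i * (1 - q i) ^ k) i) := by
      ext i
      by_cases hi : i ∈ A <;> simp [hi]
    have h0 : ∀ i, 0 ≤ A.indicator (fun i => q i * (1 - q i) ^ k) i := fun i =>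
      Set.indicator_nonneg (fun i _ => mul_nonneg (h.pos i).le (h.one_sub_pow_mem i k).1) i
    rw [e, ← ENNReal.ofReal_tsum_of_nonneg h0 (h.summable_freshProb A k),
      ENNReal.toReal_ofReal (tsum_nonneg h0)]
  · intro i j hij
    refine Set.disjoint_left.2 fun ω h1 h2 => hij (Subtype.ext ?_)
    simp only [Set.mem_iInter, Finset.mem_range] at h1 h2
    have h1' : X 0 ω = i := by simpa using h1 0 (by omega)
    have h2' : X 0 ω = j := by simpa using h2 0 (by omega)
    exact h1'.symm.trans h2'
  · intro i
    exact Finset.measurableSet_biInter _ fun n _ => hX n MeasurableSet.of_discrete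

end Iid

/-! ### Move-to-front positions and miss probabilities. -/

theorem mtfPosition_le_distinctCount {A : Set ℕ} {r : ℤ → ℕ} {k : ℕ} (hA : r 0 ∈ A)
    (hk : ∃ j < k, r (-((j + 1 : ℕ) : ℤ)) = r 0) :
    mtfPosition A r 0 (r 0) ≤ distinctCount A k fun n => r (-(n : ℤ)) := by
  obtain ⟨j, hj, hr⟩ := hk
  have hex : ∃ t < (0 : ℤ), r t = r 0 := ⟨_, by omega, hr⟩
  -- The requested item itself accounts for the `1 +` in its position.
  have hsub : insert (r 0) {e | e ∈ A ∧ MoreRecent r 0 e (r 0)} ⊆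
      distinctItems A k fun n => r (-(n : ℤ)) := by
    rintro e (rfl | ⟨he, t, ht, rfl, htr⟩)
    · exact ⟨hA, j, hj, hr⟩
    · have htj : -((j + 1 : ℕ) : ℤ) < t := by
        by_contra! hle
        exact htr _ hle (by omega) hr
      obtain ⟨i, rfl⟩ : ∃ i : ℕ, t = -((i + 1 : ℕ) : ℤ) := ⟨(-t - 1).toNat, by omega⟩
      exact ⟨he, i, by omega, rfl⟩
  have hnot : r 0 ∉ {e | e ∈ A ∧ MoreRecent r 0 e (r 0)} := by
    rintro ⟨_, t, ht, htr, h⟩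
    exact h t le_rfl ht htr
  rw [mtfPosition, if_pos hex, add_comm, ← Set.encard_insert_of_notMem hnot, distinctCount,
    (finite_distinctItems _ _ _).cast_ncard_eq]
  exact Set.encard_le_encard hsub

theorem distinctCount_lt_mtfPosition {A : Set ℕ} {r : ℤ → ℕ} {k : ℕ}
    (hk : ∀ j < k, r (-((j + 1 : ℕ) : ℤ)) ≠ r 0) :
    (distinctCount A k fun n => r (-(n : ℤ)) : ℕ∞) < mtfPosition A r 0 (r 0) := by
  unfold mtfPosition
  split_ifs with hex
  · have hsub : (distinctItems A k fun n => r (-(n : ℤ))) ⊆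
        {e | e ∈ A ∧ MoreRecent r 0 e (r 0)} := by
      rintro e ⟨he, j, hj, rfl⟩
      refine ⟨he, _, by omega, rfl, fun t ht1 ht2 => ?_⟩
      obtain ⟨i, rfl⟩ : ∃ i : ℕ, t = -((i + 1 : ℕ) : ℤ) := ⟨(-t - 1).toNat, by omega⟩
      exact hk i (by omega)
    have h1 := Set.encard_le_encard hsub
    rw [← (finite_distinctItems _ _ _).cast_ncard_eq] at h1
    refine lt_of_lt_of_le ?_ (add_le_add_right h1 1)
    rw [distinctCount]
    exact_mod_cast Nat.lt_one_add_iff.2 le_rfl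
  · exact ENat.natCast_lt_top _

/-- The probability that request `0` asks for an item of `A` and misses the LRU cache of size `y`
serving the items of `A`. -/
noncomputable def missProb (ρ : Measure (ℤ → ℕ)) (A : Set ℕ) (y : ℝ) : ℝ :=
  ρ.real {r | r 0 ∈ A ∧ ENNReal.ofReal y < (mtfPosition A r 0 (r 0) : ℝ≥0∞)}

theorem singleMissProb_eq (ρ : Measure (ℤ → ℕ)) (y : ℝ) :
    singleMissProb ρ y = missProb ρ Set.univ y := by
  simp [singleMissProb, missProb, singlePosition]

theorem clusterMissProb_eq {N : ℕ} (ρ : Measure (ℤ → ℕ)) [IsFiniteMeasure ρ] (h : ℕ → Fin N)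
    (y : Fin N → ℝ) : clusterMissProb ρ h y = ∑ m, missProb ρ {e | h e = m} (y m) := by
  refine Finset.sum_congr rfl fun m _ => ?_
  have hm : MeasurableSet {r : ℤ → ℕ | server h r 0 = m} :=
    (MeasurableSet.of_discrete (s := {e | h e = m})).preimage (measurable_pi_apply 0)
  have hset : {r | server h r 0 = m} ∩ {r | ENNReal.ofReal (y m) < (clusterPosition h r 0 : ℝ≥0∞)} =
      {r | r 0 ∈ {e | h e = m} ∧
        ENNReal.ofReal (y m) < (mtfPosition {e | h e = m} r 0 (r 0) : ℝ≥0∞)} := by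
    ext r
    refine and_congr_right fun hr => ?_
    have hr' : server h r 0 = m := hr
    simp only [Set.mem_ofPred_eq, clusterPosition, hr']
  rw [serverMissProb, mul_comm, mul_comm, missProb, ← hset, measureReal_def, cond_apply hm,
    ENNReal.toReal_mul, ENNReal.toReal_inv, ← measureReal_def, ← measureReal_def]
  -- For a server of probability zero, both sides vanish.
  rcases eq_or_ne (ρ.real {r | server h r 0 = m}) 0 with h0 | h0
  · rw [h0, mul_zero]
    refine (le_antisymm ?_ measureReal_nonneg).symm
    exact h0 ▸ measureReal_mono Set.inter_subset_left
  · field_simp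

/-! ### Asymptotics for a fixed hash function. -/

section Asymptotics

variable {ρ : Measure (ℤ → ℕ)} {q : ℕ → ℝ} {α c : ℝ}

theorem tendsto_missProb [IsProbabilityMeasure ρ] (h : IsZipf q α c)
    (hind : iIndepFun (fun (n : ℤ) (r : ℤ → ℕ) => r n) ρ)
    (hlaw : ∀ (n : ℤ) i, ρ ((fun r : ℤ → ℕ => r n) ⁻¹' {i}) = ENNReal.ofReal (q i))
    {A : Set ℕ} {p : ℝ} (hp : 0 < p) (hA : HasDensity A p) :
    Tendsto (fun y : ℝ => y ^ (α - 1) * missProb ρ A y) atTop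
      (𝓝 (p ^ α * ((c ^ (1 / α) * Real.Gamma (1 - 1 / α)) ^ α / α))) := by
  have hα : 0 < α := by linarith [h.one_lt]
  have hα1 : 1 / α < 1 := by rw [div_lt_one hα]; exact h.one_lt
  have hΓ : 0 < Real.Gamma (1 - 1 / α) := Real.Gamma_pos_of_pos (by linarith)
  have hc := h.pos_const
  -- Time is reversed: index `0` is the current request and index `j + 1` lies `j + 1` steps in the
  -- past.
  have hX : ∀ n : ℕ, Measurable fun r : ℤ → ℕ => r (-(n : ℤ)) := fun n => measurable_pi_apply _
  have hindX : iIndepFun (fun (n : ℕ) (r : ℤ → ℕ) => r (-(n : ℤ))) ρ :=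
    hind.precomp (g := fun n : ℕ => -(n : ℤ)) fun a b hab => by simpa using hab
  have hlawX := fun (n : ℕ) i => hlaw (-(n : ℤ)) i
  have hfresh := measureReal_fresh h hX hindX hlawX A
  rw [← mul_div_assoc, ← Real.mul_rpow hp.le (by positivity), ← mul_assoc]
  refine tendsto_rpow_mul_of_chernoff_sandwich hα (by positivity) (h.tendsto_distinctMean hA)
    (h.tendsto_freshProb hA) (fun y z k hy hz => ?_) fun y z k hy hz hz0 => ?_
  · have hle := measureReal_le_of_pow_ge h hX hindX hlawX (by linarith : -1 < z) k A (y := y)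
      (S := {r | y ≤ distinctCount A k fun n => r (-(n : ℤ))}) (fun r hr => by
        rw [← Real.rpow_natCast]
        exact Real.rpow_le_rpow_of_exponent_le (by linarith) hr)
    rw [← hfresh]
    refine le_trans (measureReal_mono ?_) ((measureReal_union_le _ _).trans
      (add_le_add_right hle _))
    rintro r ⟨hrA, hr⟩
    by_cases hk : ∃ j < k, r (-((j + 1 : ℕ) : ℤ)) = r 0
    · right
      have h1 : (mtfPosition A r 0 (r 0) : ℝ≥0∞) ≤
          ((distinctCount A k fun n => r (-(n : ℤ)) : ℕ∞) : ℝ≥0∞) :=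
        ENat.toENNReal_le.2 (mtfPosition_le_distinctCount hrA hk)
      have h2 := (hr.trans_le h1).le
      rw [ENat.toENNReal_coe] at h2
      exact (ENNReal.ofReal_le_natCast).1 h2
    · left
      push Not at hk
      exact ⟨by simpa using hrA, fun j hj => by simpa using hk j hj⟩
  · have hle := measureReal_le_of_pow_ge h hX hindX hlawX hz k A (y := y)
      (S := {r | (distinctCount A k fun n => r (-(n : ℤ)) : ℝ) ≤ y}) (fun r hr => by
        rw [← Real.rpow_natCast]
        exact Real.rpow_le_rpow_of_exponent_ge (by linarith) (by linarith) hr)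
    rw [← hfresh, sub_le_iff_le_add]
    refine le_trans (measureReal_mono ?_) ((measureReal_union_le _ _).trans
      (add_le_add_right hle _))
    rintro r ⟨hrA, hr⟩
    rcases le_or_gt (distinctCount A k fun n => r (-(n : ℤ)) : ℝ) y with hk | hk
    · exact Or.inr hk
    · left
      have h1 : ((distinctCount A k fun n => r (-(n : ℤ)) : ℕ∞) : ℝ≥0∞) <
          (mtfPosition A r 0 (r 0) : ℝ≥0∞) :=
        ENat.toENNReal_lt.2 (distinctCount_lt_mtfPosition fun j hj => by simpa using hr j hj)
      rw [ENat.toENNReal_coe] at h1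
      refine ⟨by simpa using hrA, lt_of_le_of_lt ?_ h1⟩
      exact (ENNReal.ofReal_le_natCast).2 hk.le

theorem tendsto_missProb_const_mul [IsProbabilityMeasure ρ] (h : IsZipf q α c)
    (hind : iIndepFun (fun (n : ℤ) (r : ℤ → ℕ) => r n) ρ)
    (hlaw : ∀ (n : ℤ) i, ρ ((fun r : ℤ → ℕ => r n) ⁻¹' {i}) = ENNReal.ofReal (q i))
    {A : Set ℕ} {p b : ℝ} (hp : 0 < p) (hA : HasDensity A p) (hb : 0 < b) :
    Tendsto (fun x : ℝ => x ^ (α - 1) * missProb ρ A (b * x)) atTop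
      (𝓝 (p ^ α * b ^ (1 - α) * ((c ^ (1 / α) * Real.Gamma (1 - 1 / α)) ^ α / α))) := by
  have h1 := ((tendsto_missProb h hind hlaw hp hA).comp
    (tendsto_id.const_mul_atTop hb)).const_mul (b ^ (1 - α))
  rw [mul_comm (p ^ α), mul_assoc]
  refine h1.congr' ?_
  filter_upwards [eventually_gt_atTop 0] with x hx
  simp only [Function.comp, id]
  rw [Real.mul_rpow hb.le hx.le, ← mul_assoc, ← mul_assoc, ← Real.rpow_add hb]
  simp

theorem tendsto_clusterMissProb_div_singleMissProb [IsProbabilityMeasure ρ] (h : IsZipf q α c)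
    (hind : iIndepFun (fun (n : ℤ) (r : ℤ → ℕ) => r n) ρ)
    (hlaw : ∀ (n : ℤ) i, ρ ((fun r : ℤ → ℕ => r n) ⁻¹' {i}) = ENNReal.ofReal (q i))
    {N : ℕ} {μ b : Fin N → ℝ} (hμ : ∀ m, 0 ≤ μ m) (hb : ∀ m, 0 < b m) {g : ℕ → Fin N}
    (hdens : ∀ m, HasDensity {i | g i = m} (μ m)) (hnull : ∀ m, μ m = 0 → ∀ i, g i ≠ m) :
    Tendsto (fun x : ℝ => clusterMissProb ρ g (fun m => b m * x) /
      singleMissProb ρ (virtualSize α μ b x)) atTop (𝓝 1) := by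
  have hα : 0 < α := by linarith [h.one_lt]
  have hα1 : 1 / α < 1 := by rw [div_lt_one hα]; exact h.one_lt
  have hΓ : 0 < Real.Gamma (1 - 1 / α) := Real.Gamma_pos_of_pos (by linarith)
  have hc := h.pos_const
  set K := (c ^ (1 / α) * Real.Gamma (1 - 1 / α)) ^ α / α with hK
  have hK0 : 0 < K := by positivity
  set S := ∑ m, μ m ^ α * b m ^ (1 - α) with hS
  have hS0 : 0 < S := by
    have h0 : 0 < μ (g 0) := lt_of_le_of_ne (hμ _) fun h0 => hnull _ h0.symm 0 rfl
    have hb0 := hb (g 0)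
    refine lt_of_lt_of_le (b := μ (g 0) ^ α * b (g 0) ^ (1 - α)) (by positivity) ?_
    exact Finset.single_le_sum (f := fun m => μ m ^ α * b m ^ (1 - α))
      (fun m _ => by have := hμ m; have := hb m; positivity) (Finset.mem_univ _)
  have hcluster : Tendsto (fun x : ℝ => x ^ (α - 1) * clusterMissProb ρ g fun m => b m * x) atTop
      (𝓝 (S * K)) := by
    simp only [clusterMissProb_eq, Finset.mul_sum, hS, Finset.sum_mul]
    refine tendsto_finsetSum _ fun m _ => ?_
    -- The miss asymptotics need positive density; a server with `μ m = 0` is handled by having no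
    -- items at all.
    rcases (hμ m).eq_or_lt with h0 | h0
    · have he : {i | g i = m} = ∅ := Set.eq_empty_of_forall_notMem fun i => hnull m h0.symm i
      simp [missProb, he, ← h0, Real.zero_rpow hα.ne']
    · exact tendsto_missProb_const_mul h hind hlaw h0 (hdens m) (hb m)
  have hs0 : 0 < S ^ (-1 / (α - 1)) := by positivity
  have hsingle : Tendsto (fun x : ℝ => x ^ (α - 1) * singleMissProb ρ (virtualSize α μ b x)) atTop
      (𝓝 (S * K)) := by
    have h1 := tendsto_missProb_const_mul h hind hlaw one_pos hasDensity_univ hs0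
    have hα' : α - 1 ≠ 0 := by linarith [h.one_lt]
    -- This identity determines the virtual size: scaling a cache by `s` multiplies the limit by `s
    -- ^ (1 - α)`, which must equal `S`.
    have e : -1 / (α - 1) * (1 - α) = 1 := by field_simp; ring
    rw [← Real.rpow_mul hS0.le, e, Real.rpow_one, Real.one_rpow, one_mul] at h1
    refine h1.congr fun x => ?_
    rw [singleMissProb_eq, virtualSize, mul_comm x]
  have h2 := hcluster.div hsingle (by positivity)
  rw [div_self (by positivity)] at h2
  refine h2.congr' ?_
  filter_upwards [eventually_gt_atTop 0] with x hx
  exact mul_div_mul_left _ _ (Real.rpow_pos_of_pos hx _).ne'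

end Asymptotics

/-! ### Almost sure properties of the random hash function. -/

namespace IsModel

variable {Ω : Type*} [MeasurableSpace Ω] {P : Measure Ω} {N : ℕ}
  {μ : Fin N → ℝ} {q : ℕ → ℝ} {H : ℕ → Ω → Fin N} {R : ℤ → Ω → ℕ}

theorem measurable_requests (hM : IsModel P μ q H R) : Measurable fun ω n => R n ω :=
  measurable_pi_lambda _ hM.measurable_request

theorem measurable_hashes (hM : IsModel P μ q H R) : Measurable fun ω i => H i ω :=
  measurable_pi_lambda _ hM.measurable_hash

theorem iIndepFun_eval (hM : IsModel P μ q H R) :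
    iIndepFun (fun (n : ℤ) (r : ℤ → ℕ) => r n) (P.map fun ω n => R n ω) := by
  rw [iIndepFun_iff_measure_inter_preimage_eq_mul]
  intro S s hs
  have hm : ∀ n ∈ S, MeasurableSet ((fun r : ℤ → ℕ => r n) ⁻¹' s n) := fun n hn =>
    measurable_pi_apply n (hs n hn)
  rw [Measure.map_apply hM.measurable_requests (Finset.measurableSet_biInter S hm),
    Finset.prod_congr rfl fun n hn => Measure.map_apply hM.measurable_requests (hm n hn)]
  simp only [Set.preimage_iInter]
  exact hM.indep_request.measure_inter_preimage_eq_mul S hs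

variable [IsProbabilityMeasure P]

theorem measure_request (hM : IsModel P μ q H R) (n : ℤ) (i : ℕ) :
    P (R n ⁻¹' {i}) = ENNReal.ofReal (q i) := by
  rw [← hM.law_request n i, ofReal_measureReal]
  rfl

theorem isZipf (hM : IsModel P μ q H R) {α c : ℝ} (hα : 1 < α) (hc : 0 < c) (hanti : Antitone q)
    (hq : Tendsto (fun i : ℕ => q i / (c / ((i : ℝ) + 1) ^ α)) atTop (𝓝 1)) : IsZipf q α c where
  one_lt := hα
  pos_const := hc
  anti := hanti
  tendsto := hq
  pos i := by
    -- The asymptotics give positivity only far out; monotonicity carries it back to `i`.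
    obtain ⟨j, hj, hij⟩ := ((hq.eventually_const_lt one_pos).and (eventually_ge_atTop i)).exists
    have hpos : 0 < c / ((j : ℝ) + 1) ^ α := by positivity
    exact ((div_pos_iff_of_pos_right hpos).1 hj).trans_le (hanti hij)
  hasSum := by
    have h0 : ∀ i, 0 ≤ q i := fun i => hM.law_request 0 i ▸ measureReal_nonneg
    have h1 : ∑' i, ENNReal.ofReal (q i) = 1 := by
      simp only [← hM.measure_request 0]
      have := tsum_measure_preimage_singleton (μ := P) (f := R 0) (Set.countable_univ)
        fun y _ => hM.measurable_request 0 (measurableSet_singleton y)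
      rw [tsum_univ fun i => P (R 0 ⁻¹' {i})] at this
      rw [this, Set.preimage_univ, measure_univ]
    have hs : Summable q := by
      have := ENNReal.summable_toReal (f := fun i => ENNReal.ofReal (q i)) (by simp [h1])
      simpa only [ENNReal.toReal_ofReal (h0 _)] using this
    have h2 : ∑' i, q i = 1 := by
      have := ENNReal.ofReal_tsum_of_nonneg h0 hs
      rw [h1, ENNReal.ofReal_eq_one] at this
      exact this
    exact h2 ▸ hs.hasSum

/-- By independence the joint law is a product, so the constant kernel is a version of the
conditional law. -/
theorem requestLawGivenHash_ae_eq (hM : IsModel P μ q H R) :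
    ∀ᵐ ω ∂P, requestLawGivenHash P H R ω = P.map fun ω n => R n ω := by
  refine ae_of_ae_map (p := fun h => condDistrib (fun ω n => R n ω) (fun ω i => H i ω) P h =
    P.map fun ω n => R n ω) hM.measurable_hashes.aemeasurable ?_
  have : IsProbabilityMeasure (P.map fun ω n => R n ω) :=
    Measure.isProbabilityMeasure_map hM.measurable_requests.aemeasurable
  refine (condDistrib_ae_eq_iff_measure_eq_compProd _ hM.measurable_requests.aemeasurable
    (Kernel.const _ (P.map fun ω n => R n ω))).2 ?_
  rw [Measure.compProd_const]
  exact (indepFun_iff_map_prod_eq_prod_map_map hM.measurable_hashes.aemeasurable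
    hM.measurable_requests.aemeasurable).1 hM.indep_hash_request

theorem map_request (hM : IsModel P μ q H R) (n : ℤ) (i : ℕ) :
    P.map (fun ω n => R n ω) ((fun r : ℤ → ℕ => r n) ⁻¹' {i}) = ENNReal.ofReal (q i) := by
  rw [Measure.map_apply hM.measurable_requests
    ((measurable_pi_apply n) (measurableSet_singleton i)), ← hM.measure_request n i]
  rfl

/-- Strong law of large numbers for the indicators of `H i = m`. -/
theorem ae_hasDensity (hM : IsModel P μ q H R) (m : Fin N) :
    ∀ᵐ ω ∂P, HasDensity {i | H i ω = m} (μ m) := by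
  classical
  set f : Fin N → ℝ := ({m} : Set (Fin N)).indicator 1 with hf
  have hfm : Measurable f := Measurable.of_discrete
  have hset : ∀ i, MeasurableSet (H i ⁻¹' {m}) := fun i =>
    hM.measurable_hash i (measurableSet_singleton m)
  have hcomp : ∀ i, (f ∘ H i) = (H i ⁻¹' {m}).indicator 1 := fun i => rfl
  have hint0 : ∫ ω, (f ∘ H 0) ω ∂P = μ m := by
    rw [hcomp, integral_indicator_one (hset 0)]
    exact hM.law_hash 0 m
  have hident : ∀ i, IdentDistrib (H i) (H 0) P P := fun i =>
    { aemeasurable_fst := (hM.measurable_hash i).aemeasurable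
      aemeasurable_snd := (hM.measurable_hash 0).aemeasurable
      map_eq := by
        refine Measure.ext_of_singleton fun m' => ?_
        rw [Measure.map_apply (hM.measurable_hash i) (measurableSet_singleton m'),
          Measure.map_apply (hM.measurable_hash 0) (measurableSet_singleton m')]
        have := (hM.law_hash i m').trans (hM.law_hash 0 m').symm
        exact (measureReal_eq_measureReal_iff).1 this }
  have hslln := strong_law_ae_real (μ := P) (fun i => f ∘ H i)
    (by rw [hcomp]; exact (integrable_const (1 : ℝ)).indicator (hset 0))
    (fun i j hij => (hM.indep_hash.indepFun hij).comp hfm hfm)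
    (fun i => (hident i).comp hfm)
  filter_upwards [hslln] with ω hω
  rw [hint0] at hω
  refine hω.congr fun n => ?_
  congr 1
  simp only [countBelow, Function.comp, hf, Set.indicator, Set.mem_singleton_iff, Pi.one_apply]
  rw [Finset.sum_boole]
  congr!

theorem ae_forall_ne_of_eq_zero (hM : IsModel P μ q H R) (m : Fin N) :
    ∀ᵐ ω ∂P, μ m = 0 → ∀ i, H i ω ≠ m := by
  by_cases hm : μ m = 0
  · have : ∀ i, ∀ᵐ ω ∂P, H i ω ≠ m := fun i => by
      have h0 := hM.law_hash i m
      rw [hm, measureReal_eq_zero_iff] at h0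
      rw [ae_iff]
      simpa using h0
    filter_upwards [ae_all_iff.2 this] with ω hω _ using hω
  · exact Eventually.of_forall fun ω h0 => absurd h0 hm

end IsModel

end LRUCluster

theorem theorem2 {Ω : Type*} [MeasurableSpace Ω] (P : Measure Ω) [IsProbabilityMeasure P]
    {N : ℕ} (μ b : Fin N → ℝ) (hb : ∀ m, 0 < b m)
    (α c : ℝ) (hα : 1 < α) (hc : 0 < c)
    (q : ℕ → ℝ) (hq_anti : Antitone q)
    (hq : Tendsto (fun i : ℕ => q i / (c / ((i : ℝ) + 1) ^ α)) atTop (𝓝 1))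
    (H : ℕ → Ω → Fin N) (R : ℤ → Ω → ℕ) (hmodel : LRUCluster.IsModel P μ q H R) :
    ∀ᵐ ω ∂P, Tendsto
      (fun x : ℝ =>
        LRUCluster.clusterMissProb (LRUCluster.requestLawGivenHash P H R ω) (fun i => H i ω)
            (fun m => b m * x) /
          LRUCluster.singleMissProb (LRUCluster.requestLawGivenHash P H R ω)
            (LRUCluster.virtualSize α μ b x))
      atTop (𝓝 1) := by
  have hz := hmodel.isZipf hα hc hq_anti hq
  have hprob : IsProbabilityMeasure (P.map fun ω n => R n ω) :=
    Measure.isProbabilityMeasure_map hmodel.measurable_requests.aemeasurable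
  have hμ : ∀ m, 0 ≤ μ m := fun m => hmodel.law_hash 0 m ▸ measureReal_nonneg
  filter_upwards [hmodel.requestLawGivenHash_ae_eq, ae_all_iff.2 hmodel.ae_hasDensity,
    ae_all_iff.2 hmodel.ae_forall_ne_of_eq_zero] with ω hlaw hdens hnull
  rw [hlaw]
  exact LRUCluster.tendsto_clusterMissProb_div_singleMissProb hz hmodel.iIndepFun_eval
    hmodel.map_request hμ hb hdens hnull
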